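/- Setting. Let $(\Omega,\mathcal A,\mathbb P)$ be a probability space. The treatment takes values in $\mathcal D=\{d_1<\dots<d_J\}\subset\mathbb R$ (the binary case is $\mathcal D=\{0,1\}$) and the instrument $Z$ takes values in a finite set $\mathcal Z=\{z_1,\dots,z_K\}$. There are real potential outcomes $Y_{dz}$ ($d\in\mathcal D$, $z\in\mathcal Z$) and potential treatments $D_z\in\mathcal D$ ($z\in\mathcal Z$); the observed treatment and outcome are $D=D_Z$ and $Y=Y_{DZ}$. Let $\mathscr Z$ be the set of ordered pairs $\mathcal Z_{(k,k')}=(z_k,z_{k'})$ with $k\ne k'$; write $Z\in\mathcal Z_{(k,k')}$ for $Z\in\{z_k,z_{k'}\}$. A set $\mathscr Z_M\subset\mathscr Z$ is a validity pair set if for every $(z,z')\in\mathscr Z_M$: (i) $Y_{dz}=Y_{dz'}$ a.s. for every $d\in\mathcal D$; (ii) $Z$ is independent of the vector $(Y_{d_1z},Y_{d_1z'},\dots,Y_{d_Jz},Y_{d_Jz'},D_z,D_{z'})$; (iii) $D_{z'}\ge D_z$ a.s. The union of all validity pair sets is the largest validity pair set $\mathscr Z_{\bar M}$. For $(z,z')\in\mathscr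 Z_{\bar M}$ let $Y_d(z,z')$ denote the a.s. common value of $Y_{dz}$ and $Y_{dz'}$. For a random variable $\xi_i=\xi(Y_i,D_i,Z_i)$ and $\mathcal B\in\mathscr Z$ put $$\mathcal E_n(\xi_i,\mathcal B)=\frac{\frac1n\sum_{i=1}^n\xi_i1\{Z_i\in\mathcal B\}}{\frac1n\sum_{i=1}^n1\{Z_i\in\mathcal B\}},\qquad \mathcal E(\xi_i,\mathcal B)=\frac{E[\xi_i1\{Z_i\in\mathcal B\}]}{E[1\{Z_i\in\mathcal B\}]}.$$ Let $g:\mathcal Z\to\mathbb R$ be given, and let $\widehat{\mathscr Z_0}=\widehat{\mathscr Z_0}(n)\subset\mathscr Z$ be random sets. The VSIV estimator and its population counterpart are the vectors $\widehat\beta_1=(\widehat\beta^1_{(k,k')})_{k\neq k'}$ and $\beta_1=(\beta^1_{(k,k')})_{k\ne k'}$ with $$\widehat\beta^1_{(k,k')}=1\{\mathcal Z_{(k,k')}\in\widehat{\mathscr Z_0}\}\cdot\frac{\mathcal E_n(g(Z_i)Y_i,\mathcal Z_{(k,k')})-\mathcal E_n(g(Z_i),\mathcal Z_{(k,k')})\,\mathcal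 E_n(Y_i,\mathcal Z_{(k,k')})}{\mathcal E_n(g(Z_i)D_i,\mathcal Z_{(k,k')})-\mathcal E_n(g(Z_i),\mathcal Z_{(k,k')})\,\mathcal E_n(D_i,\mathcal Z_{(k,k')})},$$ $$\beta^1_{(k,k')}=1\{\mathcal Z_{(k,k')}\in\mathscr Z_{\bar M}\}\cdot\frac{\mathcal E(g(Z_i)Y_i,\mathcal Z_{(k,k')})-\mathcal E(g(Z_i),\mathcal Z_{(k,k')})\,\mathcal E(Y_i,\mathcal Z_{(k,k')})}{\mathcal E(g(Z_i)D_i,\mathcal Z_{(k,k')})-\mathcal E(g(Z_i),\mathcal Z_{(k,k')})\,\mathcal E(D_i,\mathcal Z_{(k,k')})},$$ where a product with a zero indicator is $0$ and a ratio with zero denominator is given the value $0$. Theorem. Suppose that 1. $(Y_i,D_i,Z_i)_{i\ge1}$ is an i.i.d. sequence with the law of $(Y,D,Z)$, $E[Y^2]<\infty$, and for every $(z,z')\in\mathscr Z_{\bar M}$ and $2\le j\le J$ the variable $(Y_{d_j}(z,z')-Y_{d_{j-1}}(z,z'))1\{D_{z'}\ge d_j>D_z\}$ is integrable; 2. for every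 $\mathcal Z_{(k,k')}\in\mathscr Z_{\bar M}$, $E[g(Z_i)D_i|Z_i\in\mathcal Z_{(k,k')}]-E[D_i|Z_i\in\mathcal Z_{(k,k')}]\,E[g(Z_i)|Z_i\in\mathcal Z_{(k,k')}]\neq0$ (nothing of this kind is assumed for pairs outside $\mathscr Z_{\bar M}$); 3. $\mathbb P(\widehat{\mathscr Z_0}=\mathscr Z_{\bar M})\to1$ as $n\to\infty$. Then $\sqrt n(\widehat\beta_1-\beta_1)\overset{d}{\to}N(0,\Sigma)$, where $\Sigma$ is the positive semidefinite matrix $\Sigma=\mathcal J\Sigma_P\mathcal J^T$ defined as follows. Let $$W_i(\mathcal B)=\big(g(Z_i)Y_i,\;Y_i,\;g(Z_i),\;g(Z_i)D_i,\;D_i,\;1\big)^T\,1\{Z_i\in\mathcal B\},\qquad W(\mathcal B)=E[W_i(\mathcal B)],$$ let $\Sigma_P$ be the covariance matrix of the stacked vector $(W_i(\mathcal B))_{\mathcal B\in\mathscr Z}$, and let $$f(x)=\frac{x_1/x_6-x_2x_3/x_6^2}{x_4/x_6-x_5x_3/x_6^2},\qquad x\in\mathbb R^6.$$ The row of $\mathcal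 J$ indexed by $\mathcal B\in\mathscr Z_{\bar M}$ has the gradient $f'(W(\mathcal B))^T$ in the block of columns indexed by $\mathcal B$ and zeros elsewhere; the rows indexed by $\mathcal B\notin\mathscr Z_{\bar M}$ are zero. Moreover, for every $(z_k,z_{k'})\in\mathscr Z_{\bar M}$, $\beta^1_{(k,k')}$ equals the average causal response $$\beta_{k',k}=\sum_{j=2}^J\omega_j\,E\big[Y_{d_j}(z_k,z_{k'})-Y_{d_{j-1}}(z_k,z_{k'})\,\big|\,D_{z_{k'}}\ge d_j>D_{z_k}\big]=\frac{E[Y|Z=z_{k'}]-E[Y|Z=z_k]}{E[D|Z=z_{k'}]-E[D|Z=z_k]},$$ $$\omega_j=\frac{\mathbb P(D_{z_{k'}}\ge d_j>D_{z_k})}{\sum_{l=2}^J(d_l-d_{l-1})\,\mathbb P(D_{z_{k'}}\ge d_l>D_{z_k})}$$ (a term with $\mathbb P(D_{z_{k'}}\ge d_j>D_{z_k})=0$ is $0$). In the binary case $\mathcal D=\{0,1\}$ it equals the local average treatment effect $E[Y_1(z_k,z_{k'})-Y_0(z_k,z_{k'})\,|\,D_{z_{k'}}>D_{z_k}]$.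 -/

import Mathlib

open MeasureTheory ProbabilityTheory Filter Topology

noncomputable section

namespace VSIV

/-- A potential-outcome model with an ordered treatment taking the `J = m + 1` values
`level 0 < level 1 < ⋯ < level m` and an instrument with values in the finite set `𝒵`.
`outcome j z` is the potential outcome `Y_{d z}` for `d = level j`. The potential treatment at the
instrument value `z` is recorded through its index: `choice z ω = j` means `D_z = level j`. -/
structure Model (Ω 𝒵 : Type*) [MeasurableSpace Ω] [MeasurableSpace 𝒵] (m : ℕ) where
  level : Fin (m + 1) → ℝ
  level_strictMono : StrictMono level
  outcome : Fin (m + 1) → 𝒵 → Ω → ℝ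
  outcome_measurable : ∀ j z, Measurable (outcome j z)
  choice : 𝒵 → Ω → Fin (m + 1)
  choice_measurable : ∀ z, Measurable (choice z)
  instrument : Ω → 𝒵
  instrument_measurable : Measurable instrument

/-- An observation `(Y, D, Z)`. -/
abbrev Obs (𝒵 : Type*) := ℝ × ℝ × 𝒵

/-- Ordered pairs `(z, z')` of distinct instrument values. -/
abbrev InstrPair (𝒵 : Type*) := {p : 𝒵 × 𝒵 // p.1 ≠ p.2}

/-- The indicator `1{z ∈ {z_k, z_{k'}}}` of a pair `(z_k, z_{k'})`. -/
def pairInd {𝒵 : Type*} (p : InstrPair 𝒵) (z : 𝒵) : ℝ :=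
  Set.indicator ({p.1.1, p.1.2} : Set 𝒵) (fun _ => (1 : ℝ)) z

namespace Model

variable {Ω 𝒵 : Type*} [MeasurableSpace Ω] [MeasurableSpace 𝒵] {m : ℕ}

/-- The potential treatment `D_z`. -/
def potTreat (M : Model Ω 𝒵 m) (z : 𝒵) (ω : Ω) : ℝ := M.level (M.choice z ω)

/-- The observed treatment `D = D_Z`. -/
def treat (M : Model Ω 𝒵 m) (ω : Ω) : ℝ := M.potTreat (M.instrument ω) ω

/-- The observed outcome `Y = Y_{D Z}`. -/
def resp (M : Model Ω 𝒵 m) (ω : Ω) : ℝ :=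
  M.outcome (M.choice (M.instrument ω) ω) (M.instrument ω) ω

/-- The observable vector `(Y, D, Z)`. -/
def observed (M : Model Ω 𝒵 m) (ω : Ω) : Obs 𝒵 := (M.resp ω, M.treat ω, M.instrument ω)

/-- The three validity conditions (exclusion, random assignment, monotonicity) for `(z, z')`. -/
structure IsValidPair (M : Model Ω 𝒵 m) (P : Measure Ω) (z z' : 𝒵) : Prop where
  exclusion : ∀ j, M.outcome j z =ᵐ[P] M.outcome j z'
  random_assignment :
    IndepFun M.instrument
      (fun ω => ((fun j => M.outcome j z ω), (fun j => M.outcome j z' ω),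
        M.potTreat z ω, M.potTreat z' ω)) P
  monotonicity : ∀ᵐ ω ∂P, M.potTreat z ω ≤ M.potTreat z' ω

/-- A validity pair set: every pair in it satisfies the validity conditions. -/
def IsValidityPairSet (M : Model Ω 𝒵 m) (P : Measure Ω) (S : Set (InstrPair 𝒵)) : Prop :=
  ∀ p ∈ S, M.IsValidPair P p.1.1 p.1.2

/-- The largest validity pair set: the union of all validity pair sets. -/
def largestValidityPairSet (M : Model Ω 𝒵 m) (P : Measure Ω) : Set (InstrPair 𝒵) :=
  ⋃₀ {S | M.IsValidityPairSet P S}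

theorem mem_largestValidityPairSet (M : Model Ω 𝒵 m) (P : Measure Ω) (p : InstrPair 𝒵) :
    p ∈ M.largestValidityPairSet P ↔ M.IsValidPair P p.1.1 p.1.2 := by
  constructor
  · rintro ⟨S, hS, hp⟩
    exact hS p hp
  · intro h
    refine ⟨{p}, ?_, rfl⟩
    rintro q rfl
    exact h

/-- The event `D_{z'} ≥ d_j > D_z`, where `d_j = level j.succ` and so
`d_{j-1} = level j.castSucc`. -/
def complierEvent (M : Model Ω 𝒵 m) (p : InstrPair 𝒵) (j : Fin m) : Set Ω :=
  {ω | M.level j.succ ≤ M.potTreat p.1.2 ω ∧ M.potTreat p.1.1 ω < M.level j.succ}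

/-- `Y_{d_j}(z, z') - Y_{d_{j-1}}(z, z')`. Under the exclusion restriction `Y_d(z, z')` is the
almost surely common value of `Y_{d z}` and `Y_{d z'}`; the version `Y_{d z}` is used. -/
def increment (M : Model Ω 𝒵 m) (p : InstrPair 𝒵) (j : Fin m) (ω : Ω) : ℝ :=
  M.outcome j.succ p.1.1 ω - M.outcome j.castSucc p.1.1 ω

/-- The weight `ω_j` of the average causal response. -/
def acrWeight (M : Model Ω 𝒵 m) (P : Measure Ω) (p : InstrPair 𝒵) (j : Fin m) : ℝ :=
  P.real (M.complierEvent p j) /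
    ∑ l : Fin m, (M.level l.succ - M.level l.castSucc) * P.real (M.complierEvent p l)

/-- The average causal response `β_{k',k}` of the pair `(z_k, z_{k'})`. -/
def acr (M : Model Ω 𝒵 m) (P : Measure Ω) (p : InstrPair 𝒵) : ℝ :=
  ∑ j : Fin m, M.acrWeight P p j * ∫ ω, M.increment p j ω ∂(P[|M.complierEvent p j])

/-- For a binary treatment, the local average treatment effect
`E[Y_1(z, z') - Y_0(z, z') | D_{z'} > D_z]`. -/
def late (M : Model Ω 𝒵 m) (P : Measure Ω) (p : InstrPair 𝒵) : ℝ :=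
  ∫ ω, (M.outcome (Fin.last m) p.1.1 ω - M.outcome 0 p.1.1 ω)
    ∂(P[|{ω | M.potTreat p.1.1 ω < M.potTreat p.1.2 ω}])

/-- The ratio `(E[Y|Z=z'] - E[Y|Z=z]) / (E[D|Z=z'] - E[D|Z=z])`. -/
def wald (M : Model Ω 𝒵 m) (P : Measure Ω) (p : InstrPair 𝒵) : ℝ :=
  ((∫ ω, M.resp ω ∂(P[|M.instrument ⁻¹' {p.1.2}]))
      - ∫ ω, M.resp ω ∂(P[|M.instrument ⁻¹' {p.1.1}])) /
    ((∫ ω, M.treat ω ∂(P[|M.instrument ⁻¹' {p.1.2}]))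
      - ∫ ω, M.treat ω ∂(P[|M.instrument ⁻¹' {p.1.1}]))

/-- `𝓔(ξ, {z, z'}) = E[ξ 1{Z ∈ {z, z'}}] / E[1{Z ∈ {z, z'}}]`, the conditional mean of
`ξ = ξ(Y, D, Z)` given `Z ∈ {z, z'}`. -/
def pairMean (M : Model Ω 𝒵 m) (P : Measure Ω) (p : InstrPair 𝒵) (ξ : Obs 𝒵 → ℝ) : ℝ :=
  (∫ ω, ξ (M.observed ω) * pairInd p (M.instrument ω) ∂P) /
    ∫ ω, pairInd p (M.instrument ω) ∂P

end Model

variable {Ω 𝒵 : Type*}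

/-- `𝓔_n(ξ_i, {z, z'})`, the mean of `ξ(Y_i, D_i, Z_i)` over the observations `i` among the first
`n` with `Z_i ∈ {z, z'}`. -/
def samplePairMean (obs : ℕ → Ω → Obs 𝒵) (n : ℕ) (ω : Ω) (p : InstrPair 𝒵)
    (ξ : Obs 𝒵 → ℝ) : ℝ :=
  (1 / (n : ℝ) * ∑ i ∈ Finset.range n, ξ (obs i ω) * pairInd p (obs i ω).2.2) /
    (1 / (n : ℝ) * ∑ i ∈ Finset.range n, pairInd p (obs i ω).2.2)

/-- `E[g(Z) D] - E[g(Z)] E[D]` for a given mean operator `E`. -/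
def firstStage (g : 𝒵 → ℝ) (E : (Obs 𝒵 → ℝ) → ℝ) : ℝ :=
  E (fun o => g o.2.2 * o.2.1) - E (fun o => g o.2.2) * E (fun o => o.2.1)

/-- `E[g(Z) Y] - E[g(Z)] E[Y]` for a given mean operator `E`. -/
def reducedForm (g : 𝒵 → ℝ) (E : (Obs 𝒵 → ℝ) → ℝ) : ℝ :=
  E (fun o => g o.2.2 * o.1) - E (fun o => g o.2.2) * E (fun o => o.1)

/-- The vector of VSIV estimators: the pairwise IV estimators multiplied by
`1{(z, z') ∈ Ẑ₀}`, where `S = Ẑ₀`. -/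
def vsivEstimator (g : 𝒵 → ℝ) (obs : ℕ → Ω → Obs 𝒵) (n : ℕ) (ω : Ω)
    (S : Set (InstrPair 𝒵)) : EuclideanSpace ℝ (InstrPair 𝒵) :=
  WithLp.toLp 2 fun p => S.indicator (fun q =>
    reducedForm g (samplePairMean obs n ω q) / firstStage g (samplePairMean obs n ω q)) p

/-- The vector `β₁` of population coefficients; its entries outside the largest validity pair set
are zero. -/
def vsivTarget [MeasurableSpace Ω] [MeasurableSpace 𝒵] {m : ℕ} (M : Model Ω 𝒵 m)
    (P : Measure Ω) (g : 𝒵 → ℝ) : EuclideanSpace ℝ (InstrPair 𝒵) :=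
  WithLp.toLp 2 fun p => (M.largestValidityPairSet P).indicator (fun q =>
    reducedForm g (M.pairMean P q) / firstStage g (M.pairMean P q)) p

/-- The vector `W(z, z')` built from one observation:
`(g(Z)Y, Y, g(Z), g(Z)D, D, 1) · 1{Z ∈ {z, z'}}`. -/
def momentVec (g : 𝒵 → ℝ) (p : InstrPair 𝒵) (o : Obs 𝒵) : Fin 6 → ℝ :=
  ![g o.2.2 * o.1 * pairInd p o.2.2, o.1 * pairInd p o.2.2, g o.2.2 * pairInd p o.2.2,
    g o.2.2 * o.2.1 * pairInd p o.2.2, o.2.1 * pairInd p o.2.2, pairInd p o.2.2]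

/-- The gradient of `f(x) = (x₁/x₆ - x₂x₃/x₆²) / (x₄/x₆ - x₅x₃/x₆²)`; the coordinates
`x₁, …, x₆` are `x 0, …, x 5`. -/
def ratioGrad (x : Fin 6 → ℝ) : Fin 6 → ℝ :=
  let den := x 3 * x 5 - x 4 * x 2
  let num := x 0 * x 5 - x 1 * x 2
  ![x 5 / den,
    -x 2 / den,
    (-(x 1 * x 3 * x 5) + x 4 * x 0 * x 5) / den ^ 2,
    -(num * x 5) / den ^ 2,
    x 2 * num / den ^ 2,
    (-(x 0 * x 4 * x 2) + x 1 * x 2 * x 3) / den ^ 2]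

/-- `Σ_P`, the covariance matrix of the stacked vector of all `W(z, z')`. -/
def momentCov [MeasurableSpace Ω] [MeasurableSpace 𝒵] {m : ℕ} (M : Model Ω 𝒵 m)
    (P : Measure Ω) (g : 𝒵 → ℝ) : Matrix (InstrPair 𝒵 × Fin 6) (InstrPair 𝒵 × Fin 6) ℝ :=
  Matrix.of fun a b =>
    cov[fun ω => momentVec g a.1 (M.observed ω) a.2,
      fun ω => momentVec g b.1 (M.observed ω) b.2; P]

/-- The Jacobian at the population moments of the map sending the stacked moments to the vector of
pairwise IV ratios, with the rows of pairs outside the largest validity pair set replaced by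
zero. -/
def selectedJacobian [DecidableEq 𝒵] [MeasurableSpace Ω] [MeasurableSpace 𝒵] {m : ℕ}
    (M : Model Ω 𝒵 m) (P : Measure Ω) (g : 𝒵 → ℝ) :
    Matrix (InstrPair 𝒵) (InstrPair 𝒵 × Fin 6) ℝ :=
  Matrix.of fun p a => (M.largestValidityPairSet P).indicator (fun q =>
    if a.1 = q then
      ratioGrad (fun l => ∫ ω, momentVec g q (M.observed ω) l ∂P) a.2
    else 0) p

/-- The asymptotic covariance matrix `Σ`. -/
def asymptoticCov [Fintype 𝒵] [DecidableEq 𝒵] [MeasurableSpace Ω] [MeasurableSpace 𝒵] {m : ℕ}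
    (M : Model Ω 𝒵 m) (P : Measure Ω) (g : 𝒵 → ℝ) :
    Matrix (InstrPair 𝒵) (InstrPair 𝒵) ℝ :=
  selectedJacobian M P g * momentCov M P g * (selectedJacobian M P g).transpose

end VSIV

end

/-! Asymptotics. On the event that the selected set equals the largest validity pair set, the
estimator coincides with an oracle estimator that uses the true set. The event has probability
tending to one, so both have the same limit law, and the ratios of invalid pairs, however
degenerate, play no role (`tendstoInDistribution_of_eqOn`). The oracle estimator is a fixed function
of the sample mean of the stacked vectors W. The multivariate central limit theorem gives the
fluctuations of that mean. A nonzero first stage makes the function differentiable at the population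
mean, so the delta method sends the Gaussian limit to its image under the Jacobian
(`tendstoInDistribution_selectedRatio`).

Identification. Given Z in {z, z'}, the covariance of g(Z) with Y or D is one common factor times
the difference of the conditional means at z' and z. The factor cancels in the ratio and leaves the
Wald ratio (`pairMean_ratio_eq_wald`). Independence turns conditional means into means of potential
variables. Exclusion and monotonicity make both differences telescope over the treatment levels,
each step being active exactly on its complier event (`acr_eq_wald`). -/

open scoped RealInnerProductSpace Matrix

namespace VSIV

/-! ### Multivariate central limit theorem and linear images of Gaussian laws -/

section Gaussian

variable {Ω ι κ : Type*} [MeasurableSpace Ω] {P : Measure Ω} [Fintype ι] [Fintype κ]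

theorem variance_sum_const_mul [IsProbabilityMeasure P] {X : ι → Ω → ℝ}
    (hX : ∀ i, MemLp (X i) 2 P) (t : ι → ℝ) :
    Var[fun ω => ∑ i, t i * X i ω; P] =
      t ⬝ᵥ (Matrix.of fun i j => cov[X i, X j; P]) *ᵥ t := by
  rw [variance_fun_sum fun i => (hX i).const_mul (t i)]
  simp only [covariance_const_mul_left, covariance_const_mul_right, dotProduct, Matrix.mulVec,
    Matrix.of_apply, Finset.mul_sum]
  exact Finset.sum_congr rfl fun i _ => Finset.sum_congr rfl fun j _ => by ring

theorem posSemidef_covariance [IsProbabilityMeasure P] {X : ι → Ω → ℝ}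
    (hX : ∀ i, MemLp (X i) 2 P) :
    (Matrix.of fun i j => cov[X i, X j; P]).PosSemidef := by
  refine Matrix.PosSemidef.of_dotProduct_mulVec_nonneg ?_ fun t => ?_
  · ext i j
    simp [covariance_comm]
  · rw [star_trivial, ← variance_sum_const_mul hX]
    exact variance_nonneg _ _

/-- Cramér–Wold through characteristic functions: the value at `t` is that of the scalar sum of ⟪t,
X k⟫ at frequency 1, and the variance of ⟪t, X 0⟫ is the quadratic form of the covariance matrix at
`t`. -/
theorem tendstoInDistribution_multivariateGaussian [IsProbabilityMeasure P] [DecidableEq ι]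
    {X : ℕ → Ω → EuclideanSpace ℝ ι} (hX : MemLp (X 0) 2 P) (hindep : iIndepFun X P)
    (hident : ∀ i, IdentDistrib (X i) (X 0) P P) :
    TendstoInDistribution
      (fun (n : ℕ) ω => (√(n : ℝ))⁻¹ • (∑ k ∈ Finset.range n, X k ω - (n : ℝ) • P[X 0]))
      atTop id (fun _ => P)
      (multivariateGaussian 0
        (Matrix.of fun i j => cov[fun ω => X 0 ω i, fun ω => X 0 ω j; P])) := by
  have hcoord (i : ι) : MemLp (fun ω => X 0 ω i) 2 P :=
    (EuclideanSpace.proj (𝕜 := ℝ) i).comp_memLp' hX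
  have hmeas (k : ℕ) : AEMeasurable (X k) P := (hident k).aemeasurable_fst
  have hsum (n : ℕ) : AEMeasurable
      (fun ω => (√(n : ℝ))⁻¹ • (∑ k ∈ Finset.range n, X k ω - (n : ℝ) • P[X 0])) P := by
    have := Finset.aemeasurable_fun_sum (Finset.range n) fun k _ => hmeas k
    have hg (v : EuclideanSpace ℝ ι) :
        Measurable fun x : EuclideanSpace ℝ ι => (√(n : ℝ))⁻¹ • (x - v) := by fun_prop
    exact (hg _).comp_aemeasurable this
  refine ⟨hsum, by fun_prop, ProbabilityMeasure.tendsto_iff_tendsto_charFun.2 fun t => ?_⟩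
  have hproj : ∀ ω, ⟪t, X 0 ω⟫ = ∑ i, t i * X 0 ω i := fun ω => by
    simp [PiLp.inner_apply, mul_comm]
  have hvar : Var[fun ω => ⟪t, X 0 ω⟫; P] =
      t ⬝ᵥ (Matrix.of fun i j => cov[fun ω => X 0 ω i, fun ω => X 0 ω j; P]) *ᵥ t := by
    simp_rw [hproj]
    exact variance_sum_const_mul hcoord _
  have hclt := tendstoInDistribution_inv_sqrt_mul_sum_sub (P := P)
    (P' := gaussianReal 0 Var[fun ω => ⟪t, X 0 ω⟫; P].toNNReal) (Y := id)
    (X := fun k ω => ⟪t, X k ω⟫) ⟨by fun_prop, Measure.map_id⟩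
    ((innerSL ℝ t).comp_memLp' hX)
    (hindep.comp (fun _ x => ⟪t, x⟫) fun _ => by fun_prop)
    fun i => (hident i).comp (u := fun x => ⟪t, x⟫) (by fun_prop)
  have hlim := ProbabilityMeasure.tendsto_iff_tendsto_charFun.1 hclt.tendsto 1
  simp only [ProbabilityMeasure.coe_mk, Measure.map_id] at hlim ⊢
  rw [charFun_multivariateGaussian (posSemidef_covariance hcoord)]
  rw [charFun_gaussianReal, hvar, Real.coe_toNNReal _ (hvar ▸ variance_nonneg _ _)] at hlim
  convert hlim using 2 with n
  · have hclt' := hclt.forall_aemeasurable n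
    simp only [charFun_apply]
    rw [integral_map (hsum n) (by fun_prop), integral_map hclt' (by fun_prop)]
    congr 1
    ext ω
    congr 3
    rw [real_inner_comm, inner_smul_right, inner_sub_right, inner_sum, inner_smul_right,
      integral_inner (hX.integrable (by norm_num))]
    simp
  · simp [dotProduct]

/-- The characteristic function of the image at `t` is the original one at Aᵀt, whose quadratic form
is that of A S Aᵀ at `t`. -/
theorem map_toLpLin_multivariateGaussian [DecidableEq ι] [DecidableEq κ] (A : Matrix κ ι ℝ)
    {S : Matrix ι ι ℝ} (hS : S.PosSemidef) :
    (multivariateGaussian 0 S).map (Matrix.toLpLin 2 2 A) =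
      multivariateGaussian 0 (A * S * A.transpose) := by
  have hS' : (A * S * A.transpose).PosSemidef := by
    simpa using hS.mul_mul_conjTranspose_same A
  have hcont : Continuous (Matrix.toLpLin 2 2 A : EuclideanSpace ℝ ι →ₗ[ℝ] _) :=
    LinearMap.continuous_of_finiteDimensional _
  have : IsProbabilityMeasure ((multivariateGaussian 0 S).map (Matrix.toLpLin 2 2 A)) :=
    Measure.isProbabilityMeasure_map hcont.aemeasurable
  refine Measure.ext_of_charFun ?_
  ext t
  have hmap : charFun ((multivariateGaussian 0 S).map (Matrix.toLpLin 2 2 A)) t =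
      charFun (multivariateGaussian 0 S) (WithLp.toLp 2 (A.transpose *ᵥ t)) := by
    simp only [charFun_apply]
    rw [integral_map hcont.aemeasurable (by fun_prop)]
    congr 1
    ext x
    congr 3
    simp only [EuclideanSpace.inner_eq_star_dotProduct, star_trivial, Matrix.ofLp_toLpLin,
      Matrix.toLin'_apply]
    rw [Matrix.dotProduct_mulVec, Matrix.mulVec_transpose]
  rw [hmap, charFun_multivariateGaussian hS, charFun_multivariateGaussian hS']
  simp only [inner_zero_right]
  congr 4
  rw [← Matrix.mulVec_mulVec, ← Matrix.mulVec_mulVec, Matrix.dotProduct_mulVec _ A,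
    ← Matrix.mulVec_transpose]

end Gaussian

/-! ### Delta method -/

section DeltaMethod

variable {Ω Ω' E F : Type*} [MeasurableSpace Ω] {P : Measure Ω} [IsProbabilityMeasure P]
  [MeasurableSpace Ω'] {P' : Measure Ω'} [IsProbabilityMeasure P']
  [NormedAddCommGroup E] [NormedSpace ℝ E] [MeasurableSpace E] [BorelSpace E]
  [SecondCountableTopology E]
  [NormedAddCommGroup F] [NormedSpace ℝ F] [MeasurableSpace F] [BorelSpace F]
  [SecondCountableTopology F]

/-- Slutsky's theorem applied to the scaled error and the relative Taylor remainder. Almost sure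
consistency makes the remainder vanish directly, so the rates `a n` need not diverge. -/
theorem tendstoInDistribution_delta_method {X : ℕ → Ω → E} {θ : E} {f : E → F} {f' : E →L[ℝ] F}
    {a : ℕ → ℝ} {Z : Ω' → E} (ha : ∀ n, 0 ≤ a n) (hf : Measurable f) (hf' : HasFDerivAt f f' θ)
    (hX : ∀ n, AEMeasurable (X n) P)
    (hlim : ∀ᵐ ω ∂P, Tendsto (fun n => X n ω) atTop (𝓝 θ))
    (hdist : TendstoInDistribution (fun n ω => a n • (X n ω - θ)) atTop Z (fun _ => P) P') :
    TendstoInDistribution (fun n ω => a n • (f (X n ω) - f θ)) atTop (fun ω => f' (Z ω))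
      (fun _ => P) P' := by
  -- Since `0⁻¹ = 0`, `r θ = 0`; hence `r` tends to 0 along the full neighbourhood filter of `θ`,
  -- not just the punctured one.
  set r : E → F := fun x => ‖x - θ‖⁻¹ • (f x - f θ - f' (x - θ)) with hr
  have hr_meas : Measurable r := by
    refine Measurable.smul (by fun_prop) ((hf.sub_const _).sub ?_)
    exact f'.continuous.measurable.comp (measurable_id.sub_const θ)
  have hr_lim : Tendsto r (𝓝 θ) (𝓝 0) := by
    rw [tendsto_zero_iff_norm_tendsto_zero]
    simpa [hr, norm_smul] using hasFDerivAt_iff_tendsto.1 hf'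
  have hrX (n : ℕ) : AEMeasurable (fun ω => r (X n ω)) P := hr_meas.comp_aemeasurable (hX n)
  have hr_prob : TendstoInMeasure P (fun n ω => r (X n ω)) atTop (fun _ => (0 : F)) := by
    refine tendstoInMeasure_of_tendsto_ae (fun n => (hrX n).aestronglyMeasurable) ?_
    filter_upwards [hlim] with ω hω using hr_lim.comp hω
  have hG : Continuous fun z : E × F => f' z.1 + ‖z.1‖ • z.2 := by fun_prop
  have key := hdist.continuous_comp_prodMk_of_tendstoInMeasure_const hG hr_prob hrX
  have hX_eq (n : ℕ) (ω : Ω) :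
      f' (a n • (X n ω - θ)) + ‖a n • (X n ω - θ)‖ • r (X n ω) = a n • (f (X n ω) - f θ) := by
    rcases eq_or_ne (X n ω) θ with h | h
    · simp [h]
    · have : ‖X n ω - θ‖ ≠ 0 := norm_ne_zero_iff.2 (sub_ne_zero.2 h)
      rw [norm_smul, Real.norm_of_nonneg (ha n), map_smul, hr, smul_smul, mul_assoc,
        mul_inv_cancel₀ this, mul_one, ← smul_add, add_sub_cancel]
  simpa only [hX_eq, norm_zero, zero_smul, add_zero, smul_zero] using key

end DeltaMethod

/-! ### Selection with probability tending to one -/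

section SelectionEvent

variable {Ω Ω' E : Type*} [MeasurableSpace Ω] {P : Measure Ω} [IsProbabilityMeasure P]
  [MeasurableSpace Ω'] {P' : Measure Ω'} [IsProbabilityMeasure P']
  [NormedAddCommGroup E] [MeasurableSpace E] [BorelSpace E] [SecondCountableTopology E]

/-- Changing the random variables off events whose probabilities tend to one does not affect the
limit in distribution. -/
theorem tendstoInDistribution_of_eqOn {X Y : ℕ → Ω → E} {Z : Ω' → E} {A : ℕ → Set Ω}
    (hX : TendstoInDistribution X atTop Z (fun _ => P) P') (hY : ∀ n, AEMeasurable (Y n) P)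
    (hA : ∀ n, MeasurableSet (A n)) (hPA : Tendsto (fun n => P (A n)) atTop (𝓝 1))
    (hXY : ∀ n, Set.EqOn (X n) (Y n) (A n)) :
    TendstoInDistribution Y atTop Z (fun _ => P) P' := by
  refine tendstoInDistribution_of_tendstoInMeasure_sub Y Z hX ?_ hY
  rw [tendstoInMeasure_iff_norm]
  intro ε hε
  have hcompl : Tendsto (fun n => P (A n)ᶜ) atTop (𝓝 0) := by
    simp_rw [prob_compl_eq_one_sub (hA _)]
    simpa using ENNReal.Tendsto.sub tendsto_const_nhds hPA (Or.inl ENNReal.one_ne_top)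
  refine tendsto_of_tendsto_of_tendsto_of_le_of_le tendsto_const_nhds hcompl
    (fun _ => zero_le) fun n => measure_mono fun ω hω hωA => ?_
  have : Y n ω - X n ω = 0 := sub_eq_zero.2 (hXY n hωA).symm
  simp only [Set.mem_ofPred_eq, Pi.sub_apply, Pi.zero_apply, this, sub_zero, norm_zero] at hω
  exact absurd hω (not_le.2 hε)

end SelectionEvent

/-! ### Telescoping over treatment levels and conditional means -/

theorem fin_eq_add_sum_increments {m : ℕ} (F : Fin (m + 1) → ℝ) (c : Fin (m + 1)) :
    F c = F 0 + ∑ j : Fin m, if j.succ ≤ c then F j.succ - F j.castSucc else 0 := by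
  induction c using Fin.induction with
  | zero => simp
  | succ i ih =>
    -- Raising the index from `i.castSucc` to `i.succ` switches on exactly the summand `j = i`.
    have hsplit (j : Fin m) : (if j.succ ≤ i.succ then F j.succ - F j.castSucc else 0) =
        (if j.succ ≤ i.castSucc then F j.succ - F j.castSucc else 0) +
          if j = i then F j.succ - F j.castSucc else 0 := by
      have h1 : j.succ ≤ i.succ ↔ (j : ℕ) ≤ i := Fin.succ_le_succ_iff
      have h2 : j.succ ≤ i.castSucc ↔ (j : ℕ) < i := Iff.rfl
      have h3 : j = i ↔ (j : ℕ) = i := Fin.ext_iff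
      simp only [h1, h2, h3]
      rcases lt_trichotomy (j : ℕ) i with h | h | h
      · simp [h, h.le, h.ne]
      · simp [h]
      · simp [h.not_ge, h.not_gt, h.ne']
    simp_rw [hsplit, Finset.sum_add_distrib]
    rw [← add_assoc, ← ih]
    simp

/-- Applied both to the treatment levels and to the potential outcomes; the condition on `j` is
membership in the complier event. -/
theorem fin_sub_eq_sum_increments {m : ℕ} (F : Fin (m + 1) → ℝ) {c c' : Fin (m + 1)}
    (h : c ≤ c') :
    F c' - F c =
      ∑ j : Fin m, if j.succ ≤ c' ∧ c < j.succ then F j.succ - F j.castSucc else 0 := by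
  rw [fin_eq_add_sum_increments F c', fin_eq_add_sum_increments F c, add_sub_add_left_eq_sub,
    ← Finset.sum_sub_distrib]
  refine Finset.sum_congr rfl fun j _ => ?_
  by_cases h1 : j.succ ≤ c
  · simp [h1, h1.trans h]
  · simp [h1, not_le.1 h1]

/-- Null events are allowed: both sides are then 0. -/
theorem integral_cond_eq_div {Ω : Type*} [MeasurableSpace Ω] {P : Measure Ω} {s : Set Ω} (X : Ω → ℝ) :
    ∫ ω, X ω ∂(P[|s]) = (∫ ω in s, X ω ∂P) / P.real s := by
  rw [ProbabilityTheory.cond, integral_smul_measure, div_eq_inv_mul, smul_eq_mul,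
    ENNReal.toReal_inv, Measure.real]

section Conditioning

variable {Ω 𝒵 : Type*} [MeasurableSpace Ω] [MeasurableSpace 𝒵] [MeasurableSingletonClass 𝒵]
  {P : Measure Ω} [IsProbabilityMeasure P]

theorem map_cond_eq_of_indepFun {β : Type*} [MeasurableSpace β] {Z : Ω → 𝒵} {V : Ω → β}
    (hZ : Measurable Z) (hV : Measurable V) (h : IndepFun Z V P) {z : 𝒵}
    (hz : P (Z ⁻¹' {z}) ≠ 0) : (P[|Z ⁻¹' {z}]).map V = P.map V := by
  ext s hs
  have hmeas : MeasurableSet (Z ⁻¹' {z}) := hZ (measurableSet_singleton z)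
  rw [Measure.map_apply hV hs, Measure.map_apply hV hs, cond_apply hmeas,
    h.measure_inter_preimage_eq_mul _ _ (measurableSet_singleton z) hs, ← mul_assoc,
    ENNReal.inv_mul_cancel hz (measure_ne_top _ _), one_mul]

/-- If `X` agrees with `V` when `Z = z` and `V` is independent of `Z`, then the conditional mean
of `X` given `Z = z` is the mean of `V`. -/
theorem integral_cond_eq_of_indepFun {Z : Ω → 𝒵} {X V : Ω → ℝ} (hZ : Measurable Z)
    (hV : Measurable V) (h : IndepFun Z V P) {z : 𝒵} (hz : P (Z ⁻¹' {z}) ≠ 0)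
    (hX : Integrable X P) (hXV : ∀ ω, Z ω = z → X ω = V ω) :
    Integrable V P ∧ ∫ ω, X ω ∂(P[|Z ⁻¹' {z}]) = ∫ ω, V ω ∂P := by
  have hmeas : MeasurableSet (Z ⁻¹' {z}) := hZ (measurableSet_singleton z)
  have hae : X =ᵐ[P[|Z ⁻¹' {z}]] V := by
    filter_upwards [ae_cond_mem hmeas] with ω hω using hXV ω hω
  -- Equality of the two laws of `V` transfers integrability as well as the mean, so integrability
  -- of potential variables follows from that of the observed ones.
  have hid : IdentDistrib V V (P[|Z ⁻¹' {z}]) P :=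
    ⟨hV.aemeasurable, hV.aemeasurable, map_cond_eq_of_indepFun hZ hV h hz⟩
  refine ⟨hid.integrable_iff.1 (Integrable.congr ?_ hae), ?_⟩
  · exact (hX.restrict.smul_measure (ENNReal.inv_ne_top.2 hz))
  · rw [integral_congr_ae hae, hid.integral_eq]

end Conditioning

/-! ### Identification: Wald ratio, average causal response and local average treatment effect -/

namespace Model

variable {Ω 𝒵 : Type*} [MeasurableSpace Ω] [MeasurableSpace 𝒵] {m : ℕ}

/-- The potential outcome `Y_{D_z z}` at the instrument value `z`. -/
noncomputable def potResp (M : Model Ω 𝒵 m) (z : 𝒵) (ω : Ω) : ℝ := M.outcome (M.choice z ω) z ω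

/-- The outcome selected by a treatment level. -/
noncomputable def select (M : Model Ω 𝒵 m) (y : Fin (m + 1) → ℝ) (d : ℝ) : ℝ :=
  ∑ j, ({M.level j} : Set ℝ).indicator (fun _ => y j) d

theorem select_level (M : Model Ω 𝒵 m) (y : Fin (m + 1) → ℝ) (c : Fin (m + 1)) :
    M.select y (M.level c) = y c := by
  rw [select, Finset.sum_eq_single c]
  · simp
  · intro j _ hj
    simp [M.level_strictMono.injective.ne hj.symm]
  · simp

theorem measurable_select (M : Model Ω 𝒵 m) :
    Measurable fun v : (Fin (m + 1) → ℝ) × ℝ => M.select v.1 v.2 := by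
  refine Finset.measurable_fun_sum _ fun j _ => ?_
  have : (fun v : (Fin (m + 1) → ℝ) × ℝ =>
      ({M.level j} : Set ℝ).indicator (fun _ => v.1 j) v.2) =
      (Prod.snd ⁻¹' {M.level j}).indicator fun v : (Fin (m + 1) → ℝ) × ℝ => v.1 j := by
    ext v
    classical simp [Set.indicator_apply]
  rw [this]
  exact Measurable.indicator (by fun_prop) (measurable_snd (measurableSet_singleton _))

theorem measurable_potTreat (M : Model Ω 𝒵 m) (z : 𝒵) : Measurable (M.potTreat z) :=
  (measurable_of_countable M.level).comp (M.choice_measurable z)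

/-- Random assignment concerns the real-valued treatment, not its index. This form exhibits the
potential outcome as a measurable function of the vector independent of the instrument. -/
theorem potResp_eq_select (M : Model Ω 𝒵 m) (z : 𝒵) (ω : Ω) :
    M.potResp z ω = M.select (fun j => M.outcome j z ω) (M.potTreat z ω) :=
  (M.select_level (fun j => M.outcome j z ω) (M.choice z ω)).symm

theorem measurable_potResp (M : Model Ω 𝒵 m) (z : 𝒵) : Measurable (M.potResp z) := by
  simp_rw [funext (M.potResp_eq_select z)]
  exact M.measurable_select.comp
    ((measurable_pi_lambda _ fun j => M.outcome_measurable j z).prodMk (M.measurable_potTreat z))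

theorem measurableSet_complierEvent (M : Model Ω 𝒵 m) (p : InstrPair 𝒵) (j : Fin m) :
    MeasurableSet (M.complierEvent p j) :=
  (measurableSet_le measurable_const (M.measurable_potTreat _)).inter
    (measurableSet_lt (M.measurable_potTreat _) measurable_const)

theorem mem_complierEvent (M : Model Ω 𝒵 m) (p : InstrPair 𝒵) (j : Fin m) (ω : Ω) :
    ω ∈ M.complierEvent p j ↔ j.succ ≤ M.choice p.1.2 ω ∧ M.choice p.1.1 ω < j.succ := by
  simp [complierEvent, potTreat, M.level_strictMono.le_iff_le, M.level_strictMono.lt_iff_lt]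

theorem indepFun_of_isValidPair (M : Model Ω 𝒵 m) {P : Measure Ω} {z z' : 𝒵}
    (hv : M.IsValidPair P z z') :
    IndepFun M.instrument (M.potResp z) P ∧ IndepFun M.instrument (M.potResp z') P ∧
      IndepFun M.instrument (M.potTreat z) P ∧ IndepFun M.instrument (M.potTreat z') P := by
  have hcomp (ψ : (Fin (m + 1) → ℝ) × (Fin (m + 1) → ℝ) × ℝ × ℝ → ℝ) (hψ : Measurable ψ) :
      IndepFun M.instrument (fun ω => ψ ((fun j => M.outcome j z ω),
        (fun j => M.outcome j z' ω), M.potTreat z ω, M.potTreat z' ω)) P :=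
    hv.random_assignment.comp measurable_id hψ
  refine ⟨?_, ?_, hcomp (fun v => v.2.2.1) (by fun_prop), hcomp (fun v => v.2.2.2) (by fun_prop)⟩
  · rw [funext (M.potResp_eq_select z)]
    refine hcomp (fun v => M.select v.1 v.2.2.1) (M.measurable_select.comp
      (f := fun v : (Fin (m + 1) → ℝ) × (Fin (m + 1) → ℝ) × ℝ × ℝ => (v.1, v.2.2.1)) ?_)
    fun_prop
  · rw [funext (M.potResp_eq_select z')]
    refine hcomp (fun v => M.select v.2.1 v.2.2.2) (M.measurable_select.comp
      (f := fun v : (Fin (m + 1) → ℝ) × (Fin (m + 1) → ℝ) × ℝ × ℝ => (v.2.1, v.2.2.2)) ?_)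
    fun_prop

/-- For a binary treatment the average causal response is the local average treatment effect. -/
theorem acr_eq_late (M : Model Ω 𝒵 m) (P : Measure Ω) (p : InstrPair 𝒵) (hlevel : Set.range M.level = {0, 1})
    (h : ∑ j : Fin m, (M.level j.succ - M.level j.castSucc) * P.real (M.complierEvent p j) ≠ 0) :
    M.acr P p = M.late P p := by
  have hm : m = 1 := by
    have hcard := Set.ncard_range_of_injective M.level_strictMono.injective
    rw [hlevel, Set.ncard_pair zero_ne_one, Nat.card_fin] at hcard
    omega
  subst hm
  have hmono : M.level 0 < M.level 1 := M.level_strictMono (by decide)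
  have hmem (i : Fin 2) : M.level i = 0 ∨ M.level i = 1 := by
    have : M.level i ∈ Set.range M.level := ⟨i, rfl⟩
    rwa [hlevel] at this
  have h0 : M.level 0 = 0 := by
    rcases hmem 0 with h | h
    · exact h
    · rcases hmem 1 with h' | h' <;> linarith
  have h1 : M.level 1 = 1 := by
    rcases hmem 1 with h | h
    · linarith
    · exact h
  have hset : M.complierEvent p 0 = {ω | M.potTreat p.1.1 ω < M.potTreat p.1.2 ω} := by
    ext ω
    rw [mem_complierEvent, Set.mem_ofPred_eq, potTreat, potTreat, M.level_strictMono.lt_iff_lt]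
    simp only [Fin.lt_def, Fin.le_def]
    have := (M.choice p.1.2 ω).isLt
    simp
    omega
  -- `h` reduces to the single complier event having nonzero probability, so its weight is 1.
  simp only [Finset.univ_unique, Fin.default_eq_zero, Finset.sum_singleton, Fin.succ_zero_eq_one,
    Fin.castSucc_zero, h0, h1, sub_zero, one_mul] at h
  simp [acr, acrWeight, late, increment, ← hset, h0, h1, div_self h]

variable {P : Measure Ω} [IsProbabilityMeasure P]

/-- The weighted sum of complier probabilities is the mean change in the treatment. -/
theorem integral_potTreat_sub (M : Model Ω 𝒵 m) {p : InstrPair 𝒵}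
    (hv : M.IsValidPair P p.1.1 p.1.2) :
    ∫ ω, (M.potTreat p.1.2 ω - M.potTreat p.1.1 ω) ∂P =
      ∑ j : Fin m, (M.level j.succ - M.level j.castSucc) * P.real (M.complierEvent p j) := by
  have hae : (fun ω => M.potTreat p.1.2 ω - M.potTreat p.1.1 ω) =ᵐ[P] fun ω =>
      ∑ j : Fin m, (M.complierEvent p j).indicator
        (fun _ => M.level j.succ - M.level j.castSucc) ω := by
    filter_upwards [hv.monotonicity] with ω hω
    rw [potTreat, potTreat,
      fin_sub_eq_sum_increments M.level (M.level_strictMono.le_iff_le.1 hω)]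
    classical simp [Set.indicator_apply, mem_complierEvent]
  rw [integral_congr_ae hae, integral_finsetSum]
  · refine Finset.sum_congr rfl fun j _ => ?_
    rw [integral_indicator (M.measurableSet_complierEvent p j), setIntegral_const, smul_eq_mul,
      mul_comm]
  · exact fun j _ => (integrable_const _).indicator (M.measurableSet_complierEvent p j)

/-- Exclusion places both potential outcomes on the same function of the treatment level, and
monotonicity orders the two chosen levels, so their difference telescopes. -/
theorem integral_potResp_sub (M : Model Ω 𝒵 m) {P : Measure Ω} {p : InstrPair 𝒵}
    (hv : M.IsValidPair P p.1.1 p.1.2)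
    (hinc : ∀ j : Fin m, IntegrableOn (M.increment p j) (M.complierEvent p j) P) :
    ∫ ω, (M.potResp p.1.2 ω - M.potResp p.1.1 ω) ∂P =
      ∑ j : Fin m, ∫ ω in M.complierEvent p j, M.increment p j ω ∂P := by
  have hae : (fun ω => M.potResp p.1.2 ω - M.potResp p.1.1 ω) =ᵐ[P] fun ω =>
      ∑ j : Fin m, (M.complierEvent p j).indicator (M.increment p j) ω := by
    filter_upwards [hv.monotonicity, ae_all_iff.2 hv.exclusion] with ω hω hex
    rw [potResp, potResp, ← hex,
      fin_sub_eq_sum_increments (fun j => M.outcome j p.1.1 ω)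
        (M.level_strictMono.le_iff_le.1 hω)]
    classical simp [Set.indicator_apply, mem_complierEvent, increment]
  rw [integral_congr_ae hae, integral_finsetSum]
  · exact Finset.sum_congr rfl fun j _ => integral_indicator (M.measurableSet_complierEvent p j)
  · exact fun j _ => (integrable_indicator_iff (M.measurableSet_complierEvent p j)).2 (hinc j)

/-- The probability of each complier event cancels between the weight and the conditional mean; a
null event contributes 0 to either side. -/
theorem acr_eq_div (M : Model Ω 𝒵 m) (p : InstrPair 𝒵) :
    M.acr P p = (∑ j : Fin m, ∫ ω in M.complierEvent p j, M.increment p j ω ∂P) /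
      ∑ j : Fin m, (M.level j.succ - M.level j.castSucc) * P.real (M.complierEvent p j) := by
  rw [acr, Finset.sum_div]
  refine Finset.sum_congr rfl fun j _ => ?_
  rw [acrWeight, integral_cond_eq_div]
  rcases eq_or_ne (P.real (M.complierEvent p j)) 0 with h | h
  · have h0 : P (M.complierEvent p j) = 0 := (measureReal_eq_zero_iff).1 h
    simp [h, setIntegral_measure_zero _ h0]
  · field_simp

variable [MeasurableSingletonClass 𝒵]

theorem integral_cond_treat_sub (M : Model Ω 𝒵 m) {p : InstrPair 𝒵}
    (hv : M.IsValidPair P p.1.1 p.1.2) (htreat : Integrable M.treat P)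
    (h1 : P (M.instrument ⁻¹' {p.1.1}) ≠ 0) (h2 : P (M.instrument ⁻¹' {p.1.2}) ≠ 0) :
    (∫ ω, M.treat ω ∂(P[|M.instrument ⁻¹' {p.1.2}]))
        - ∫ ω, M.treat ω ∂(P[|M.instrument ⁻¹' {p.1.1}]) =
      ∫ ω, (M.potTreat p.1.2 ω - M.potTreat p.1.1 ω) ∂P := by
  obtain ⟨-, -, ht1, ht2⟩ := M.indepFun_of_isValidPair hv
  have htreat_eq (z : 𝒵) (ω : Ω) (hω : M.instrument ω = z) : M.treat ω = M.potTreat z ω := by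
    simp [treat, hω]
  obtain ⟨i1, e1⟩ := integral_cond_eq_of_indepFun M.instrument_measurable
    (M.measurable_potTreat _) ht1 h1 htreat (htreat_eq _)
  obtain ⟨i2, e2⟩ := integral_cond_eq_of_indepFun M.instrument_measurable
    (M.measurable_potTreat _) ht2 h2 htreat (htreat_eq _)
  rw [e1, e2, integral_sub i2 i1]

theorem integral_cond_resp_sub (M : Model Ω 𝒵 m) {p : InstrPair 𝒵}
    (hv : M.IsValidPair P p.1.1 p.1.2) (hresp : Integrable M.resp P)
    (h1 : P (M.instrument ⁻¹' {p.1.1}) ≠ 0) (h2 : P (M.instrument ⁻¹' {p.1.2}) ≠ 0) :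
    (∫ ω, M.resp ω ∂(P[|M.instrument ⁻¹' {p.1.2}]))
        - ∫ ω, M.resp ω ∂(P[|M.instrument ⁻¹' {p.1.1}]) =
      ∫ ω, (M.potResp p.1.2 ω - M.potResp p.1.1 ω) ∂P := by
  obtain ⟨hr1, hr2, -, -⟩ := M.indepFun_of_isValidPair hv
  have hresp_eq (z : 𝒵) (ω : Ω) (hω : M.instrument ω = z) : M.resp ω = M.potResp z ω := by
    simp [resp, potResp, hω]
  obtain ⟨i1, e1⟩ := integral_cond_eq_of_indepFun M.instrument_measurable
    (M.measurable_potResp _) hr1 h1 hresp (hresp_eq _)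
  obtain ⟨i2, e2⟩ := integral_cond_eq_of_indepFun M.instrument_measurable
    (M.measurable_potResp _) hr2 h2 hresp (hresp_eq _)
  rw [e1, e2, integral_sub i2 i1]

theorem acr_eq_wald (M : Model Ω 𝒵 m) {p : InstrPair 𝒵} (hv : M.IsValidPair P p.1.1 p.1.2)
    (hresp : Integrable M.resp P) (htreat : Integrable M.treat P)
    (hinc : ∀ j : Fin m, IntegrableOn (M.increment p j) (M.complierEvent p j) P)
    (h1 : P (M.instrument ⁻¹' {p.1.1}) ≠ 0) (h2 : P (M.instrument ⁻¹' {p.1.2}) ≠ 0) :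
    M.acr P p = M.wald P p := by
  rw [wald, M.integral_cond_resp_sub hv hresp h1 h2,
    M.integral_cond_treat_sub hv htreat h1 h2, M.integral_potResp_sub hv hinc,
    M.integral_potTreat_sub hv, acr_eq_div]

theorem integral_mul_pairInd (M : Model Ω 𝒵 m) {P : Measure Ω} (p : InstrPair 𝒵) {X : Ω → ℝ}
    (hX : Integrable X P) :
    ∫ ω, X ω * pairInd p (M.instrument ω) ∂P =
      (∫ ω in M.instrument ⁻¹' {p.1.1}, X ω ∂P) + ∫ ω in M.instrument ⁻¹' {p.1.2}, X ω ∂P := by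
  have hm (z : 𝒵) : MeasurableSet (M.instrument ⁻¹' {z}) :=
    M.instrument_measurable (measurableSet_singleton z)
  rw [← integral_indicator (hm _), ← integral_indicator (hm _),
    ← integral_add (hX.indicator (hm _)) (hX.indicator (hm _))]
  congr 1
  ext ω
  by_cases h1 : M.instrument ω = p.1.1
  · simp [pairInd, h1, p.2]
  · by_cases h2 : M.instrument ω = p.1.2
    · simp [pairInd, h2, p.2.symm]
    · simp [pairInd, h1, h2]

/-- On a two-point set g(Z) is affine in 1{Z = z'}, so only g(z') - g(z) and the two cell integrals
matter. If the pair has probability zero, both sides are 0 by the division convention. -/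
theorem pairMean_cov (M : Model Ω 𝒵 m) (p : InstrPair 𝒵) (g : 𝒵 → ℝ)
    {ξ : Obs 𝒵 → ℝ} (hξ : Integrable (fun ω => ξ (M.observed ω)) P)
    (hgξ : Integrable (fun ω => g (M.instrument ω) * ξ (M.observed ω)) P)
    (hgi : Integrable (fun ω => g (M.instrument ω)) P) :
    M.pairMean P p (fun o => g o.2.2 * ξ o)
        - M.pairMean P p (fun o => g o.2.2) * M.pairMean P p ξ =
      (g p.1.2 - g p.1.1) *
        (P.real (M.instrument ⁻¹' {p.1.1}) *
            (∫ ω in M.instrument ⁻¹' {p.1.2}, ξ (M.observed ω) ∂P)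
          - P.real (M.instrument ⁻¹' {p.1.2}) *
            ∫ ω in M.instrument ⁻¹' {p.1.1}, ξ (M.observed ω) ∂P) /
        (P.real (M.instrument ⁻¹' {p.1.1}) + P.real (M.instrument ⁻¹' {p.1.2})) ^ 2 := by
  have hm (z : 𝒵) : MeasurableSet (M.instrument ⁻¹' {z}) :=
    M.instrument_measurable (measurableSet_singleton z)
  have hset (z : 𝒵) (X : Ω → ℝ) :
      ∫ ω in M.instrument ⁻¹' {z}, g (M.instrument ω) * X ω ∂P =
        g z * ∫ ω in M.instrument ⁻¹' {z}, X ω ∂P := by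
    rw [← integral_const_mul]
    refine setIntegral_congr_fun (hm z) fun ω hω => ?_
    simp only [Set.mem_preimage, Set.mem_singleton_iff] at hω
    simp [hω]
  have hone := M.integral_mul_pairInd p (P := P) (X := fun _ => 1) (integrable_const _)
  have hgone := M.integral_mul_pairInd p hgi
  have hset1 (z : 𝒵) := hset z fun _ => 1
  simp only [one_mul, mul_one, setIntegral_const, smul_eq_mul] at hone hset1
  simp only [hset1] at hgone
  have hgX := M.integral_mul_pairInd p hgξ
  simp only [hset] at hgX
  simp only [pairMean]
  have e1 : ∀ ω, (M.observed ω).2.2 = M.instrument ω := fun _ => rfl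
  simp only [e1]
  rw [hone, hgone, hgX, M.integral_mul_pairInd p hξ]
  rcases eq_or_ne
    (P.real (M.instrument ⁻¹' {p.1.1}) + P.real (M.instrument ⁻¹' {p.1.2})) 0 with h | h
  · simp [h]
  · field_simp
    ring

/-- The first stage is a product whose factors include both cell probabilities and the change in
mean treatment, so its being nonzero makes each of them nonzero. -/
theorem pairMean_ratio_eq_wald (M : Model Ω 𝒵 m) (p : InstrPair 𝒵) (g : 𝒵 → ℝ)
    (hresp : Integrable M.resp P) (htreat : Integrable M.treat P)
    (hgresp : Integrable (fun ω => g (M.instrument ω) * M.resp ω) P)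
    (hgtreat : Integrable (fun ω => g (M.instrument ω) * M.treat ω) P)
    (hgi : Integrable (fun ω => g (M.instrument ω)) P)
    (hfs : firstStage g (M.pairMean P p) ≠ 0) :
    P (M.instrument ⁻¹' {p.1.1}) ≠ 0 ∧ P (M.instrument ⁻¹' {p.1.2}) ≠ 0 ∧
      (∫ ω, M.treat ω ∂(P[|M.instrument ⁻¹' {p.1.2}]))
        - (∫ ω, M.treat ω ∂(P[|M.instrument ⁻¹' {p.1.1}])) ≠ 0 ∧
      reducedForm g (M.pairMean P p) / firstStage g (M.pairMean P p) = M.wald P p := by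
  have hrf_eq := M.pairMean_cov (P := P) p g (ξ := fun o => o.1) hresp hgresp hgi
  have hfs_eq := M.pairMean_cov (P := P) p g (ξ := fun o => o.2.1) htreat hgtreat hgi
  change reducedForm g (M.pairMean P p) = _ at hrf_eq
  change firstStage g (M.pairMean P p) = _ at hfs_eq
  rw [hfs_eq] at hfs
  have h1 : P (M.instrument ⁻¹' {p.1.1}) ≠ 0 := fun h => by
    refine hfs ?_
    have h' : P.real (M.instrument ⁻¹' {p.1.1}) = 0 := (measureReal_eq_zero_iff).2 h
    simp [setIntegral_measure_zero _ h, h']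
  have h2 : P (M.instrument ⁻¹' {p.1.2}) ≠ 0 := fun h => by
    refine hfs ?_
    have h' : P.real (M.instrument ⁻¹' {p.1.2}) = 0 := (measureReal_eq_zero_iff).2 h
    simp [setIntegral_measure_zero _ h, h']
  have ha : P.real (M.instrument ⁻¹' {p.1.1}) ≠ 0 := (measureReal_ne_zero_iff).2 h1
  have hb : P.real (M.instrument ⁻¹' {p.1.2}) ≠ 0 := (measureReal_ne_zero_iff).2 h2
  have hnum : ∀ x y : ℝ, P.real (M.instrument ⁻¹' {p.1.1}) * x
      - P.real (M.instrument ⁻¹' {p.1.2}) * y =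
      P.real (M.instrument ⁻¹' {p.1.1}) * P.real (M.instrument ⁻¹' {p.1.2}) *
        (x / P.real (M.instrument ⁻¹' {p.1.2}) - y / P.real (M.instrument ⁻¹' {p.1.1})) := by
    intro x y
    field_simp
  rw [hnum] at hfs hfs_eq hrf_eq
  simp only [← integral_cond_eq_div] at hfs hfs_eq hrf_eq
  simp only [ne_eq, div_eq_zero_iff, mul_eq_zero, not_or] at hfs
  obtain ⟨⟨hγ, -, hd⟩, hs⟩ := hfs
  refine ⟨h1, h2, hd, ?_⟩
  rw [hrf_eq, hfs_eq, div_div_div_cancel_right₀ hs, wald, mul_div_mul_left _ _ hγ,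
    mul_div_mul_left _ _ (mul_ne_zero ha hb)]
  rfl

end Model

/-- The pairwise IV ratio as a function of the six moments of a pair. -/
noncomputable def pairRatio (x : Fin 6 → ℝ) : ℝ :=
  (x 0 / x 5 - x 2 / x 5 * (x 1 / x 5)) / (x 3 / x 5 - x 2 / x 5 * (x 4 / x 5))

/-! ### Differentiability of the pairwise ratio -/

section Ratio

variable {κ : Type*} [Fintype κ]

theorem pairRatio_of_ne_zero {x : Fin 6 → ℝ} (h : x 5 ≠ 0) :
    pairRatio x = (x 0 * x 5 - x 1 * x 2) / (x 3 * x 5 - x 4 * x 2) := by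
  have h1 (a b c : ℝ) : a / x 5 - b / x 5 * (c / x 5) = (a * x 5 - c * b) / x 5 ^ 2 := by
    field_simp
  rw [pairRatio, h1, h1, div_div_div_cancel_right₀ (pow_ne_zero 2 h)]

theorem measurable_pairRatio : Measurable pairRatio := by
  unfold pairRatio
  fun_prop

theorem hasFDerivAt_pairRatio {x : Fin 6 → ℝ} (h : x 5 ≠ 0)
    (hden : x 3 * x 5 - x 4 * x 2 ≠ 0) :
    HasFDerivAt pairRatio
      (∑ l, ratioGrad x l • ContinuousLinearMap.proj (R := ℝ) (φ := fun _ : Fin 6 => ℝ) l) x := by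
  have hp (l : Fin 6) := hasFDerivAt_apply (𝕜 := ℝ) (F' := fun _ : Fin 6 => ℝ) l x
  -- Near `x` the ratio equals a quotient of quadratic polynomials, which is the function
  -- differentiated here.
  have hder := (((hp 0).mul (hp 5)).sub ((hp 1).mul (hp 2))).mul
    ((hasDerivAt_inv hden).comp_hasFDerivAt x (((hp 3).mul (hp 5)).sub ((hp 4).mul (hp 2))))
  have hev : ∀ᶠ y : Fin 6 → ℝ in 𝓝 x, y 5 ≠ 0 :=
    (continuous_apply (5 : Fin 6)).continuousAt.eventually_ne h
  refine (hder.congr_of_eventuallyEq ?_).congr_fderiv ?_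
  · filter_upwards [hev] with y hy using pairRatio_of_ne_zero hy
  · ext v
    simp [ratioGrad, Fin.sum_univ_six]
    field_simp
    ring

/-- The vector of pairwise IV ratios over the pairs in `S`, with zeros elsewhere, as a function of
the stacked moments. -/
noncomputable def selectedRatio (S : Set κ) (x : EuclideanSpace ℝ (κ × Fin 6)) :
    EuclideanSpace ℝ κ :=
  WithLp.toLp 2 fun p => S.indicator (fun q => pairRatio fun l => x (q, l)) p

theorem measurable_selectedRatio (S : Set κ) : Measurable (selectedRatio S) := by
  refine (PiLp.continuous_toLp 2 _).measurable.comp (measurable_pi_lambda _ fun p => ?_)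
  by_cases hp : p ∈ S
  · simp only [Set.indicator_of_mem hp]
    exact measurable_pairRatio.comp (by fun_prop)
  · simp [Set.indicator_of_notMem hp]

/-- Coordinate `p` depends only on block `p`, and is constantly 0 off `S`; nondegeneracy is
therefore needed only on `S`. -/
theorem hasFDerivAt_selectedRatio [DecidableEq κ] {S : Set κ} {x : EuclideanSpace ℝ (κ × Fin 6)}
    (h : ∀ p ∈ S, x (p, 5) ≠ 0)
    (hden : ∀ p ∈ S, x (p, 3) * x (p, 5) - x (p, 4) * x (p, 2) ≠ 0) :
    HasFDerivAt (selectedRatio S)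
      (Matrix.toLpLin 2 2 (Matrix.of fun (p : κ) (a : κ × Fin 6) => S.indicator
        (fun q => if a.1 = q then ratioGrad (fun l => x (q, l)) a.2 else 0) p)).toContinuousLinearMap
      x := by
  rw [← hasFDerivWithinAt_univ, hasFDerivWithinAt_euclidean]
  intro p
  rw [hasFDerivWithinAt_univ]
  by_cases hp : p ∈ S
  · set π : EuclideanSpace ℝ (κ × Fin 6) →L[ℝ] (Fin 6 → ℝ) :=
      ContinuousLinearMap.pi fun l => EuclideanSpace.proj (𝕜 := ℝ) (p, l) with hπ
    have hder : HasFDerivAt pairRatio _ (π x) := hasFDerivAt_pairRatio (h p hp) (hden p hp)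
    have hcomp := hder.comp x π.hasFDerivAt
    refine (hcomp.congr_of_eventuallyEq ?_).congr_fderiv ?_
    · refine Eventually.of_forall fun y => ?_
      simp [selectedRatio, hp, hπ]
    · ext v
      simp [hp, hπ, Matrix.mulVec, dotProduct, Fintype.sum_prod_type, ite_mul]
  · have hzero : (fun y : EuclideanSpace ℝ (κ × Fin 6) => selectedRatio S y p) = fun _ => 0 := by
      ext y
      simp [selectedRatio, hp]
    rw [hzero]
    refine (hasFDerivAt_const (0 : ℝ) x).congr_fderiv ?_
    ext v
    simp [hp, Matrix.mulVec, dotProduct]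

end Ratio

/-! ### Limit law of the sample moments and of the oracle estimator -/

section Moments

variable {Ω 𝒵 : Type*}

/-- The vectors `W(z, z')` of all pairs, stacked. -/
noncomputable def stackedMoments (g : 𝒵 → ℝ) (o : Obs 𝒵) :
    EuclideanSpace ℝ (InstrPair 𝒵 × Fin 6) :=
  WithLp.toLp 2 fun a => momentVec g a.1 o a.2

/-- All sample dependence passes through one mean vector, which is what the delta method requires.
-/
theorem vsivEstimator_eq_selectedRatio (g : 𝒵 → ℝ) (obs : ℕ → Ω → Obs 𝒵) (n : ℕ) (ω : Ω)
    (S : Set (InstrPair 𝒵)) :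
    vsivEstimator g obs n ω S =
      selectedRatio S ((n : ℝ)⁻¹ • ∑ k ∈ Finset.range n, stackedMoments g (obs k ω)) := by
  ext p
  by_cases hp : p ∈ S
  · simp [vsivEstimator, selectedRatio, hp, reducedForm, firstStage, samplePairMean, pairRatio,
      stackedMoments, momentVec]
  · simp [vsivEstimator, selectedRatio, hp]

theorem pairRatio_integral_eq [MeasurableSpace Ω] [MeasurableSpace 𝒵] {m : ℕ} (M : Model Ω 𝒵 m)
    (P : Measure Ω) (g : 𝒵 → ℝ) (p : InstrPair 𝒵) :
    pairRatio (fun l => ∫ ω, momentVec g p (M.observed ω) l ∂P) =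
      reducedForm g (M.pairMean P p) / firstStage g (M.pairMean P p) := rfl

variable [MeasurableSpace 𝒵]

theorem measurable_momentVec [Countable 𝒵] [MeasurableSingletonClass 𝒵] (g : 𝒵 → ℝ) (p : InstrPair 𝒵) (l : Fin 6) :
    Measurable fun o : Obs 𝒵 => momentVec g p o l := by
  have hg : Measurable g := measurable_of_countable g
  have hp : Measurable (pairInd p) := measurable_of_countable _
  fin_cases l <;> simp [momentVec] <;> fun_prop

theorem measurable_stackedMoments [Countable 𝒵] [MeasurableSingletonClass 𝒵] (g : 𝒵 → ℝ) : Measurable (stackedMoments g) :=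
  (PiLp.continuous_toLp 2 _).measurable.comp
    (measurable_pi_lambda _ fun a => measurable_momentVec g a.1 a.2)

namespace Model

variable [MeasurableSpace Ω] {P : Measure Ω} {m : ℕ}

/-- A function on the finite set of instrument values is bounded. -/
theorem memLp_instrument_mul [Fintype 𝒵] [MeasurableSingletonClass 𝒵] (M : Model Ω 𝒵 m) (h : 𝒵 → ℝ) {X : Ω → ℝ}
    (hX : MemLp X 2 P) : MemLp (fun ω => h (M.instrument ω) * X ω) 2 P := by
  have hh : MemLp (fun ω => h (M.instrument ω)) ⊤ P := by
    refine memLp_top_of_bound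
      ((measurable_of_countable h).comp M.instrument_measurable).aestronglyMeasurable
      (∑ z, ‖h z‖) (Eventually.of_forall fun ω => ?_)
    exact Finset.single_le_sum (f := fun z => ‖h z‖) (fun _ _ => norm_nonneg _)
      (Finset.mem_univ (M.instrument ω))
  exact hX.mul hh

theorem memLp_treat [IsProbabilityMeasure P] (M : Model Ω 𝒵 m) (hobs : AEMeasurable M.observed P) :
    MemLp M.treat 2 P := by
  have hmeas : AEMeasurable M.treat P := hobs.snd.fst
  refine MemLp.of_bound hmeas.aestronglyMeasurable
    (∑ j, ‖M.level j‖) (Eventually.of_forall fun ω => ?_)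
  exact Finset.single_le_sum (f := fun j => ‖M.level j‖) (fun _ _ => norm_nonneg _)
    (Finset.mem_univ (M.choice (M.instrument ω) ω))

theorem memLp_momentVec [IsProbabilityMeasure P] [Fintype 𝒵] [MeasurableSingletonClass 𝒵]
    (M : Model Ω 𝒵 m) (g : 𝒵 → ℝ)
    (hobs : AEMeasurable M.observed P) (hresp : MemLp M.resp 2 P) (p : InstrPair 𝒵) (l : Fin 6) :
    MemLp (fun ω => momentVec g p (M.observed ω) l) 2 P := by
  have htreat := M.memLp_treat hobs
  have hone : MemLp (fun _ : Ω => (1 : ℝ)) 2 P := memLp_const 1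
  have hgp (X : Ω → ℝ) (hX : MemLp X 2 P) := M.memLp_instrument_mul (fun z => g z * pairInd p z) hX
  have hp (X : Ω → ℝ) (hX : MemLp X 2 P) := M.memLp_instrument_mul (pairInd p) hX
  fin_cases l
  · exact (hgp _ hresp).ae_eq (Eventually.of_forall fun ω => mul_right_comm _ _ _)
  · exact (hp _ hresp).ae_eq (Eventually.of_forall fun ω => mul_comm _ _)
  · exact (hgp _ hone).ae_eq (Eventually.of_forall fun ω => mul_one _)
  · exact (hgp _ htreat).ae_eq (Eventually.of_forall fun ω => mul_right_comm _ _ _)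
  · exact (hp _ htreat).ae_eq (Eventually.of_forall fun ω => mul_comm _ _)
  · exact (hp _ hone).ae_eq (Eventually.of_forall fun ω => mul_one _)

end Model

theorem aemeasurable_sampleMoments [MeasurableSpace Ω] [Fintype 𝒵] [DecidableEq 𝒵]
    [MeasurableSingletonClass 𝒵] {P : Measure Ω} (g : 𝒵 → ℝ) {obs : ℕ → Ω → Obs 𝒵}
    (hobs : ∀ i, AEMeasurable (obs i) P) (n : ℕ) : AEMeasurable
      (fun ω => (n : ℝ)⁻¹ • ∑ k ∈ Finset.range n, stackedMoments g (obs k ω)) P := by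
  have hsum := Finset.aemeasurable_fun_sum (Finset.range n) fun k _ =>
    (measurable_stackedMoments g).comp_aemeasurable (hobs k)
  have hsmul : Measurable fun x : EuclideanSpace ℝ (InstrPair 𝒵 × Fin 6) => (n : ℝ)⁻¹ • x := by
    fun_prop
  exact hsmul.comp_aemeasurable hsum

theorem tendstoInDistribution_stackedMoments [MeasurableSpace Ω] [Fintype 𝒵] [DecidableEq 𝒵]
    [MeasurableSingletonClass 𝒵] {P : Measure Ω} [IsProbabilityMeasure P] {m : ℕ}
    (M : Model Ω 𝒵 m) (g : 𝒵 → ℝ) {obs : ℕ → Ω → Obs 𝒵} (hindep : iIndepFun obs P)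
    (hident : ∀ i, IdentDistrib (obs i) M.observed P P) (hresp : MemLp M.resp 2 P) :
    (∀ᵐ ω ∂P, Tendsto
      (fun n : ℕ => (n : ℝ)⁻¹ • ∑ k ∈ Finset.range n, stackedMoments g (obs k ω)) atTop
      (𝓝 (∫ ω, stackedMoments g (M.observed ω) ∂P))) ∧
    TendstoInDistribution (fun (n : ℕ) ω => √(n : ℝ) •
        ((n : ℝ)⁻¹ • ∑ k ∈ Finset.range n, stackedMoments g (obs k ω)
          - ∫ ω, stackedMoments g (M.observed ω) ∂P))
      atTop id (fun _ => P) (multivariateGaussian 0 (momentCov M P g)) := by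
  have hmeas := measurable_stackedMoments g
  have hobs : AEMeasurable M.observed P := (hident 0).aemeasurable_snd
  have hid (i : ℕ) : IdentDistrib (fun ω => stackedMoments g (obs i ω))
      (fun ω => stackedMoments g (M.observed ω)) P P := (hident i).comp hmeas
  have hid0 (i : ℕ) := (hid i).trans (hid 0).symm
  have hind : iIndepFun (fun i ω => stackedMoments g (obs i ω)) P :=
    hindep.comp (fun _ => stackedMoments g) fun _ => hmeas
  have hmem : MemLp (fun ω => stackedMoments g (M.observed ω)) 2 P :=
    MemLp.of_eval_piLp fun a => M.memLp_momentVec g hobs hresp a.1 a.2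
  have hmem0 : MemLp (fun ω => stackedMoments g (obs 0 ω)) 2 P := (hid 0).memLp_iff.2 hmem
  have hmean := (hid 0).integral_eq
  -- The central limit theorem yields the covariance of the first observation; equality in law turns
  -- it into `momentCov`.
  have hcov : (Matrix.of fun a b => cov[fun ω => stackedMoments g (obs 0 ω) a,
      fun ω => stackedMoments g (obs 0 ω) b; P]) = momentCov M P g := by
    ext a b
    have hpair : IdentDistrib
        (fun ω => (stackedMoments g (obs 0 ω) a, stackedMoments g (obs 0 ω) b))
        (fun ω => (stackedMoments g (M.observed ω) a, stackedMoments g (M.observed ω) b)) P P :=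
      (hid 0).comp (u := fun x : EuclideanSpace ℝ _ => (x a, x b)) (by fun_prop)
    have ha := (hpair.comp measurable_fst).integral_eq
    have hb := (hpair.comp measurable_snd).integral_eq
    simp only [Function.comp_def] at ha hb
    simp only [Matrix.of_apply, momentCov, covariance, ha, hb]
    exact (hpair.comp (u := fun v : ℝ × ℝ =>
      (v.1 - ∫ ω, stackedMoments g (M.observed ω) a ∂P) *
        (v.2 - ∫ ω, stackedMoments g (M.observed ω) b ∂P)) (by fun_prop)).integral_eq
  refine ⟨?_, ?_⟩
  · rw [← hmean]
    exact strong_law_ae (fun i ω => stackedMoments g (obs i ω))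
      (hmem0.integrable (by norm_num)) (fun i j hij => hind.indepFun hij) hid0
  · have hclt := tendstoInDistribution_multivariateGaussian hmem0 hind hid0
    rw [hcov, hmean] at hclt
    refine hclt.congr (fun n => Eventually.of_forall fun ω => ?_) (ae_eq_refl _)
    rcases eq_or_ne n 0 with rfl | hn
    · simp
    · have hn0 : (0 : ℝ) < n := by exact_mod_cast Nat.pos_of_ne_zero hn
      have hs : (√(n : ℝ))⁻¹ = √(n : ℝ) * (n : ℝ)⁻¹ := by
        rw [← Real.sqrt_div_self, div_eq_mul_inv]
      simp only
      rw [hs, mul_smul, smul_sub (n : ℝ)⁻¹, smul_smul (n : ℝ)⁻¹, inv_mul_cancel₀ hn0.ne', one_smul]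

theorem momentCov_posSemidef [MeasurableSpace Ω] [Fintype 𝒵] [DecidableEq 𝒵]
    [MeasurableSingletonClass 𝒵] {P : Measure Ω} [IsProbabilityMeasure P] {m : ℕ}
    (M : Model Ω 𝒵 m) (g : 𝒵 → ℝ) (hobs : AEMeasurable M.observed P)
    (hresp : MemLp M.resp 2 P) : (momentCov M P g).PosSemidef :=
  posSemidef_covariance fun a : InstrPair 𝒵 × Fin 6 => M.memLp_momentVec g hobs hresp a.1 a.2

theorem tendstoInDistribution_selectedRatio [MeasurableSpace Ω] [Fintype 𝒵] [DecidableEq 𝒵]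
    [MeasurableSingletonClass 𝒵] {P : Measure Ω} [IsProbabilityMeasure P] {m : ℕ}
    (M : Model Ω 𝒵 m) (g : 𝒵 → ℝ) {obs : ℕ → Ω → Obs 𝒵} (hindep : iIndepFun obs P)
    (hident : ∀ i, IdentDistrib (obs i) M.observed P P) (hresp : MemLp M.resp 2 P)
    (hfs : ∀ p ∈ M.largestValidityPairSet P, firstStage g (M.pairMean P p) ≠ 0) :
    TendstoInDistribution
      (fun (n : ℕ) (ω : Ω) => √(n : ℝ) •
        (vsivEstimator g obs n ω (M.largestValidityPairSet P) - vsivTarget M P g))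
      atTop id (fun _ => P) (multivariateGaussian 0 (asymptoticCov M P g)) := by
  have hobs : AEMeasurable M.observed P := (hident 0).aemeasurable_snd
  obtain ⟨hlln, hclt⟩ := tendstoInDistribution_stackedMoments M g hindep hident hresp
  set θ := ∫ ω, stackedMoments g (M.observed ω) ∂P with hθ
  have hθ_apply (p : InstrPair 𝒵) (l : Fin 6) :
      θ (p, l) = ∫ ω, momentVec g p (M.observed ω) l ∂P :=
    eval_integral_piLp (fun a : InstrPair 𝒵 × Fin 6 =>
      (M.memLp_momentVec g hobs hresp a.1 a.2).integrable (by norm_num)) (p, l)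
  have htarget : vsivTarget M P g = selectedRatio (M.largestValidityPairSet P) θ := by
    ext p
    simp only [vsivTarget, selectedRatio, hθ_apply, pairRatio_integral_eq]
  have hfs_eq (p : InstrPair 𝒵) : firstStage g (M.pairMean P p) =
      θ (p, 3) / θ (p, 5) - θ (p, 2) / θ (p, 5) * (θ (p, 4) / θ (p, 5)) := by
    simp only [hθ_apply]
    rfl
  -- If the pair had probability zero, every quotient would be 0 by convention and so would the
  -- first stage.
  have hne : ∀ p ∈ M.largestValidityPairSet P, θ (p, 5) ≠ 0 := fun p hp h => by
    refine hfs p hp ?_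
    rw [hfs_eq, h]
    simp
  have hden : ∀ p ∈ M.largestValidityPairSet P,
      θ (p, 3) * θ (p, 5) - θ (p, 4) * θ (p, 2) ≠ 0 := fun p hp h => by
    refine hfs p hp ?_
    have h5 := hne p hp
    rw [hfs_eq]
    field_simp
    linarith
  have hsample (n : ℕ) : AEMeasurable
      (fun ω => (n : ℝ)⁻¹ • ∑ k ∈ Finset.range n, stackedMoments g (obs k ω)) P :=
    aemeasurable_sampleMoments g (fun k => (hident k).aemeasurable_fst) n
  have hdelta := tendstoInDistribution_delta_method (fun n => Real.sqrt_nonneg (n : ℝ))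
    (measurable_selectedRatio (M.largestValidityPairSet P))
    (hasFDerivAt_selectedRatio hne hden) hsample hlln hclt
  simp only [← vsivEstimator_eq_selectedRatio, ← htarget, hθ_apply] at hdelta
  refine ⟨hdelta.forall_aemeasurable, by fun_prop, ?_⟩
  convert hdelta.tendsto using 2
  refine congrArg _ (Subtype.ext ?_)
  exact Measure.map_id.trans (map_toLpLin_multivariateGaussian _ (momentCov_posSemidef M g hobs hresp)).symm

theorem aemeasurable_vsivEstimator [MeasurableSpace Ω] [Fintype 𝒵] [DecidableEq 𝒵]
    [MeasurableSingletonClass 𝒵] {P : Measure Ω} (g : 𝒵 → ℝ) {obs : ℕ → Ω → Obs 𝒵}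
    (hobs : ∀ i, AEMeasurable (obs i) P) (n : ℕ) {S : Ω → Set (InstrPair 𝒵)}
    (hS : ∀ p, MeasurableSet {ω | p ∈ S ω}) :
    AEMeasurable (fun ω => vsivEstimator g obs n ω (S ω)) P := by
  simp_rw [vsivEstimator_eq_selectedRatio]
  refine (PiLp.continuous_toLp 2 _).measurable.comp_aemeasurable
    (aemeasurable_pi_lambda _ fun p => ?_)
  have hratio : Measurable fun x : EuclideanSpace ℝ (InstrPair 𝒵 × Fin 6) =>
      pairRatio fun l => x (p, l) := measurable_pairRatio.comp (by fun_prop)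
  exact (hratio.comp_aemeasurable (aemeasurable_sampleMoments g hobs n)).indicator (hS p)

end Moments

end VSIV

/-! ### Asymptotic normality and identification combined -/

theorem mainTheorem1 {Ω 𝒵 : Type*} [MeasurableSpace Ω] [Fintype 𝒵] [DecidableEq 𝒵]
    [MeasurableSpace 𝒵] [MeasurableSingletonClass 𝒵]
    (P : Measure Ω) [IsProbabilityMeasure P] {m : ℕ} (M : VSIV.Model Ω 𝒵 m) (g : 𝒵 → ℝ)
    (obs : ℕ → Ω → VSIV.Obs 𝒵)
    (obs_indep : iIndepFun obs P)
    (obs_ident : ∀ i, IdentDistrib (obs i) M.observed P P)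
    (moment_resp : MemLp M.resp 2 P)
    (moment_increment : ∀ p ∈ M.largestValidityPairSet P, ∀ j : Fin m,
      IntegrableOn (M.increment p j) (M.complierEvent p j) P)
    (first_stage : ∀ p ∈ M.largestValidityPairSet P,
      VSIV.firstStage g (M.pairMean P p) ≠ 0)
    (Zhat : ℕ → Ω → Set (VSIV.InstrPair 𝒵))
    (Zhat_measurable : ∀ n p, MeasurableSet {ω | p ∈ Zhat n ω})
    (Zhat_consistent :
      Tendsto (fun n => P {ω | Zhat n ω = M.largestValidityPairSet P}) atTop (𝓝 1)) :
    (VSIV.asymptoticCov M P g).PosSemidef ∧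
    TendstoInDistribution
      (fun (n : ℕ) (ω : Ω) =>
        √(n : ℝ) • (VSIV.vsivEstimator g obs n ω (Zhat n ω) - VSIV.vsivTarget M P g))
      atTop id (fun _ => P) (multivariateGaussian 0 (VSIV.asymptoticCov M P g)) ∧
    (∀ p ∈ M.largestValidityPairSet P,
      VSIV.vsivTarget M P g p = M.acr P p ∧ M.acr P p = M.wald P p) ∧
    (Set.range M.level = {0, 1} → ∀ p ∈ M.largestValidityPairSet P,
      VSIV.vsivTarget M P g p = M.late P p) := by
  have hobs : AEMeasurable M.observed P := (obs_ident 0).aemeasurable_snd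
  have hJ := (VSIV.momentCov_posSemidef M g hobs moment_resp).mul_mul_conjTranspose_same
    (VSIV.selectedJacobian M P g)
  have htreat := M.memLp_treat hobs
  have hone : MemLp (fun _ : Ω => (1 : ℝ)) 2 P := memLp_const 1
  have hint {X : Ω → ℝ} (hX : MemLp X 2 P) : Integrable X P := hX.integrable (by norm_num)
  have hratio (p : VSIV.InstrPair 𝒵) (hp : p ∈ M.largestValidityPairSet P) :=
    M.pairMean_ratio_eq_wald p g (hint moment_resp) (hint htreat)
      (hint (M.memLp_instrument_mul g moment_resp)) (hint (M.memLp_instrument_mul g htreat))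
      (by simpa using hint (M.memLp_instrument_mul g hone)) (first_stage p hp)
  have htarget (p : VSIV.InstrPair 𝒵) (hp : p ∈ M.largestValidityPairSet P) :
      VSIV.vsivTarget M P g p = M.acr P p ∧ M.acr P p = M.wald P p := by
    obtain ⟨h1, h2, -, h⟩ := hratio p hp
    have hacr := M.acr_eq_wald ((M.mem_largestValidityPairSet P p).1 hp) (hint moment_resp)
      (hint htreat) (moment_increment p hp) h1 h2
    refine ⟨?_, hacr⟩
    rw [hacr, ← h]
    simp [VSIV.vsivTarget, hp]
  refine ⟨by simpa [VSIV.asymptoticCov] using hJ, ?_, htarget, fun hlevel p hp => ?_⟩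
  · refine VSIV.tendstoInDistribution_of_eqOn
      (VSIV.tendstoInDistribution_selectedRatio M g obs_indep obs_ident moment_resp first_stage)
      (fun n => ?_) (fun n => ?_) Zhat_consistent fun n ω hω => ?_
    · have haff : Measurable fun x : EuclideanSpace ℝ (VSIV.InstrPair 𝒵) =>
          √(n : ℝ) • (x - VSIV.vsivTarget M P g) := by fun_prop
      exact haff.comp_aemeasurable (VSIV.aemeasurable_vsivEstimator g
        (fun i => (obs_ident i).aemeasurable_fst) n (Zhat_measurable n))
    -- There are finitely many pairs, so equality of sets is a countable intersection of measurable
    -- events.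
    · have hset : {ω | Zhat n ω = M.largestValidityPairSet P} =
          ⋂ p, {ω | p ∈ Zhat n ω ↔ p ∈ M.largestValidityPairSet P} := by
        ext ω
        simp [Set.ext_iff]
      rw [hset]
      exact MeasurableSet.iInter fun p => (Zhat_measurable n p).iff (MeasurableSet.const _)
    · have hω' : Zhat n ω = M.largestValidityPairSet P := hω
      simp only [hω']
  · obtain ⟨h1, h2, hd, -⟩ := hratio p hp
    have hv := (M.mem_largestValidityPairSet P p).1 hp
    rw [(htarget p hp).1]
    -- The remaining goal is that the mean change in treatment is nonzero, which the first stage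
    -- provides.
    refine M.acr_eq_late P p hlevel ?_
    rw [← M.integral_potTreat_sub hv, ← M.integral_cond_treat_sub hv (hint htreat) h1 h2]
    exact hd
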